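/- **Theorem 1 (Universal Approximation Theorem).** Let $d\ge 2$ and $m\ge 2d$ be integers. Let $I_\psi\subseteq\mathbb R$ be an interval with $[0,1]\subseteq I_\psi$ and let $I_g\subseteq\mathbb R$ be an interval with more than one point (either may be bounded or unbounded, e.g. $I_g=\mathbb R$). For an interval $I$ let $C(I)$ be the space of real continuous functions on $I$ with the topology of uniform convergence on compact subsets of $I$ (the sup-norm topology if $I$ is compact). For $\mathcal A_g\subseteq C(I_g)$ and $\mathcal A_\psi\subseteq C(I_\psi)$ let $\mathbb K^{m,d}(\mathcal A_g,\mathcal A_\psi)\subseteq C([0,1]^d)$ be the set of all functions $$F(x)=\sum_{q=0}^{m}G_q\Big(\sum_{p=1}^{d}\Psi_{p,q}(x_p)\Big),\qquad x\in[0,1]^d,$$ with $G_q\in\mathcal A_g$ and $\Psi_{p,q}\in\mathcal A_\psi$ such that $\sum_{p=1}^d\Psi_{p,q}(x_p)\in I_g$ for all $q$ and all $x\in[0,1]^d$. Let $(\mathcal A_{M}(I_g))_{M\in\mathbb N}$ and $(\mathcal A_{M}(I_\psi))_{M\in\mathbb N}$ be families of subsets of $C(I_g)$ and $C(I_\psi)$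 (the ansatz spaces with parameter $M$), such that $\mathcal A(I_g)=\bigcup_M\mathcal A_M(I_g)$ is dense in $C(I_g)$ and $\mathcal A(I_\psi)=\bigcup_M\mathcal A_M(I_\psi)$ is dense in $C(I_\psi)$. Then: 1. $\mathbb K^{m,d}(\mathcal A(I_g),\mathcal A(I_\psi))$ is dense in $C([0,1]^d)$ in the sup norm. 2. If moreover both families are directed under inclusion (for instance increasing in $M$, or constant), then for every $f\in C([0,1]^d)$ and every $\varepsilon>0$ there are $M_g,M_\psi\in\mathbb N$ and $F\in\mathbb K^{m,d}(\mathcal A_{M_g}(I_g),\mathcal A_{M_\psi}(I_\psi))$ such that $$\|f-F\|_\infty=\sup_{x\in[0,1]^d}|f(x)-F(x)|<\varepsilon.$$ -/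

import Mathlib

/-- The `q`-th inner sum `∑ p, Ψ p q (x p)` at a point `x` of the cube `[0,1]^d`; the inner
functions live on a set `Iψ` that contains `[0,1]`. -/
noncomputable def innerSum {d m : ℕ} {Iψ : Set ℝ} (hψ : Set.Icc (0 : ℝ) 1 ⊆ Iψ)
    (Ψ : Fin d → Fin (m + 1) → C(Iψ, ℝ)) (q : Fin (m + 1)) (x : Fin d → Set.Icc (0 : ℝ) 1) : ℝ :=
  ∑ p : Fin d, Ψ p q (Set.inclusion hψ (x p))

/-- The set of two-block functions `F x = ∑_{q=0}^{m} G q (∑_{p=1}^{d} Ψ p q (x p))` on `[0,1]^d`,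
with outer functions `G q` from `Ag` and inner functions `Ψ p q` from `Aψ`. The inner sums have to
stay in the domain `Ig` of the outer functions, so that the composition makes sense. -/
def twoBlock (d m : ℕ) {Ig Iψ : Set ℝ} (hψ : Set.Icc (0 : ℝ) 1 ⊆ Iψ)
    (Ag : Set C(Ig, ℝ)) (Aψ : Set C(Iψ, ℝ)) : Set C(Fin d → Set.Icc (0 : ℝ) 1, ℝ) :=
  {F | ∃ (G : Fin (m + 1) → C(Ig, ℝ)) (Ψ : Fin d → Fin (m + 1) → C(Iψ, ℝ)),
    (∀ q, G q ∈ Ag) ∧ (∀ p q, Ψ p q ∈ Aψ) ∧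
    ∃ hI : ∀ q x, innerSum hψ Ψ q x ∈ Ig,
      ∀ x, F x = ∑ q : Fin (m + 1), G q ⟨innerSum hψ Ψ q x, hI q x⟩}

/-! This is Kolmogorov's superposition argument in approximate form. With `n = m + 1`, cut `[0,1]`
into `n` mutually shifted families of short cells, separated by gaps. Gaps of different families are
disjoint, so each coordinate of `x` lies in a gap of at most one family, and at least `n - d`
families have `x` in one of their cubes. A small perturbation makes the inner functions constant on
cells, with values independent over `ℚ`; the inner sum then identifies the cube, and an outer
function can read off `f` (`exists_near_approx_off_gapSet`). Averaging over the families leaves an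
error of about `2 * d / n * ‖f‖`, a contraction because `2 * d < n` (`exists_near_sum_comp_approx`).
Applied to the residual of a nearly optimal superposition, this would beat the infimum of all errors
unless that infimum is zero (`exists_superposition_norm_sub_lt`). Finally the inner sums are moved
well inside `Ig`, and inner and outer functions are replaced by members of the dense sets. -/

/-! ### Extension and rational independence. -/

/-- Tietze extension of a function that is continuous and bounded by `c` on a closed set. -/
theorem exists_continuousMap_eqOn_abs_le {Y : Type*} [TopologicalSpace Y] [NormalSpace Y]
    {K : Set Y} (hK : IsClosed K) {h : Y → ℝ} (hh : ContinuousOn h K) {c : ℝ} (hc : 0 ≤ c)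
    (hb : ∀ y ∈ K, |h y| ≤ c) :
    ∃ g : C(Y, ℝ), (∀ y, |g y| ≤ c) ∧ ∀ y ∈ K, g y = h y := by
  obtain ⟨g, hg, hgK⟩ := ContinuousMap.exists_restrict_eq_forall_mem_of_closed
    (t := Set.Icc (-c) c) ⟨K.domRestrict h, continuousOn_iff_continuous_domRestrict.1 hh⟩
    (fun y => abs_le.1 (hb y y.2)) ⟨0, by simpa using hc⟩ hK
  exact ⟨g, fun y => abs_le.2 (hg y), fun y hy => DFunLike.congr_fun hgK ⟨y, hy⟩⟩

/-- A countable family of reals can be approximated by one that is linearly independent over `ℚ`. -/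
theorem exists_linearIndependent_rat_near {κ : Type*} [Countable κ] (w : κ → ℝ) {δ : ℝ}
    (hδ : 0 < δ) : ∃ v : κ → ℝ, LinearIndependent ℚ v ∧ ∀ k, |v k - w k| < δ := by
  obtain ⟨e, he⟩ : ∃ e : κ → ℝ, LinearIndependent ℚ e := by
    let b := Module.Basis.ofVectorSpace ℚ ℝ
    have : Infinite (Module.Basis.ofVectorSpaceIndex ℚ ℝ) := by
      rw [Cardinal.infinite_iff, b.mk_eq_rank'', Real.rank_rat_real]
      exact Cardinal.aleph0_le_continuum
    obtain ⟨i, hi⟩ := exists_injective_nat κ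
    exact ⟨fun k => b (Infinite.natEmbedding _ (i k)), b.linearIndependent.comp _
      ((Infinite.natEmbedding _).injective.comp hi)⟩
  -- Nonzero rational factors preserve independence, and the nonzero rational multiples of `e k` are
  -- dense.
  have key : ∀ k, ∃ r : ℚˣ, |r • e k - w k| < δ := by
    intro k
    have hne : e k ≠ 0 := he.ne_zero k
    have hd : Dense {r : ℝ | ∃ q : ℚ, q ≠ 0 ∧ (q : ℝ) = r} := by
      have := (Rat.denseRange_cast (𝕜 := ℝ)).sdiff_singleton 0
      refine this.mono ?_
      rintro _ ⟨⟨q, rfl⟩, hq⟩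
      exact ⟨q, by simpa using hq, rfl⟩
    obtain ⟨_, ⟨q, hq, rfl⟩, hr⟩ := hd.exists_dist_lt (w k / e k) (div_pos hδ (abs_pos.2 hne))
    refine ⟨Units.mk0 q hq, ?_⟩
    rw [dist_comm, Real.dist_eq, lt_div_iff₀ (abs_pos.2 hne), ← abs_mul, sub_mul,
      div_mul_cancel₀ _ hne] at hr
    simpa [Units.smul_def, Rat.smul_def] using hr
  choose r hr using key
  exact ⟨r • e, he.units_smul r, hr⟩

/-- The sums `∑ i, w i (s i)` become pairwise distinct after a small perturbation of `w`. -/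
theorem exists_near_sum_injective {ι κ : Type*} [Fintype ι] [Countable κ] (w : ι → κ → ℝ) {δ : ℝ}
    (hδ : 0 < δ) : ∃ v : ι → κ → ℝ, (∀ i k, |v i k - w i k| < δ) ∧
      Function.Injective fun s : ι → κ => ∑ i, v i (s i) := by
  classical
  obtain ⟨v, hv, hvw⟩ := exists_linearIndependent_rat_near (fun z : ι × κ => w z.1 z.2) hδ
  refine ⟨fun i k => v (i, k), fun i k => hvw (i, k), fun s t hst => ?_⟩
  -- Equal sums are equal rational combinations of `v`, so the coefficients agree; the one at `(j, s
  -- j)` gives `s j = t j`.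
  have h := hv (a₁ := ∑ i, Finsupp.single (i, s i) 1) (a₂ := ∑ i, Finsupp.single (i, t i) 1)
    (by simpa using hst)
  funext j
  have hj := DFunLike.congr_fun h (j, s j)
  simp only [Finsupp.finsetSum_apply, Finsupp.single_apply, Prod.mk.injEq] at hj
  rw [Finset.sum_eq_single j, Finset.sum_eq_single j] at hj <;> simp +contextual at hj ⊢
  exact hj.symm

/-! ### Cells and gaps in `[0,1]`. -/

/-- The open gaps between the cells of the `q`-th family of intervals. -/
def gapSet (n : ℕ) (N : ℝ) (q : ℕ) : Set (Set.Icc (0 : ℝ) 1) :=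
  {x | ∃ i : ℤ, n * i + q < N * x ∧ N * x < n * i + q + 1}

/-- The number of the cell of the `q`-th family that contains `x`. -/
noncomputable def cellIndex (n : ℕ) (N : ℝ) (q : ℕ) (x : Set.Icc (0 : ℝ) 1) : ℤ :=
  ⌈(N * x - q) / n⌉

theorem isOpen_gapSet (n : ℕ) (N : ℝ) (q : ℕ) : IsOpen (gapSet n N q) := by
  have : gapSet n N q = ⋃ i : ℤ, {x : Set.Icc (0 : ℝ) 1 | n * i + q < N * x ∧ N * x < n * i + q + 1} := by
    ext x; simp [gapSet]
  rw [this]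
  refine isOpen_iUnion fun i => ?_
  rw [Set.ofPred_and]
  exact (isOpen_lt (by fun_prop) (by fun_prop)).inter (isOpen_lt (by fun_prop) (by fun_prop))

/-- After scaling by `N`, gaps are unit intervals with integer left ends, and the left end modulo
`n` determines the family. -/
theorem gapSet_unique {n : ℕ} {N : ℝ} {q r : ℕ} (hq : q < n) (hr : r < n)
    {x : Set.Icc (0 : ℝ) 1} (hxq : x ∈ gapSet n N q) (hxr : x ∈ gapSet n N r) : q = r := by
  obtain ⟨i, hi, hi'⟩ := hxq
  obtain ⟨j, hj, hj'⟩ := hxr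
  have h1 : (n * i + q : ℤ) < n * j + r + 1 := by
    have := hi.trans hj'
    exact_mod_cast this
  have h2 : (n * j + r : ℤ) < n * i + q + 1 := by
    have := hj.trans hi'
    exact_mod_cast this
  have h3 : (n * i + q : ℤ) = n * j + r := by lia
  have h4 := congrArg (· % (n : ℤ)) h3
  simp only [Int.mul_add_emod_self_left] at h4
  rw [Int.emod_eq_of_lt (by lia) (by lia), Int.emod_eq_of_lt (by lia) (by lia)] at h4
  exact_mod_cast h4

theorem abs_sub_lt_one_of_ceil_eq {a b : ℝ} (h : ⌈a⌉ = ⌈b⌉) : |a - b| < 1 := by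
  have ha := Int.le_ceil a
  have ha' := Int.ceil_lt_add_one a
  have hb := Int.le_ceil b
  have hb' := Int.ceil_lt_add_one b
  rw [h] at ha ha'
  exact abs_sub_lt_iff.2 ⟨by linarith, by linarith⟩

theorem dist_lt_of_cellIndex_eq {n : ℕ} {N : ℝ} {q : ℕ} (hn : 0 < n) (hN : 0 < N)
    {x y : Set.Icc (0 : ℝ) 1} (h : cellIndex n N q x = cellIndex n N q y) :
    dist x y < n / N := by
  have hn' : (0 : ℝ) < n := by exact_mod_cast hn
  have := abs_sub_lt_one_of_ceil_eq h
  rw [← sub_div, abs_div, abs_of_pos hn', div_lt_one hn', sub_sub_sub_cancel_right, ← mul_sub,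
    abs_mul, abs_of_pos hN] at this
  rw [Subtype.dist_eq, Real.dist_eq, lt_div_iff₀ hN, mul_comm]
  exact this

/-- The ceiling attaches each gap to the cell on its right. Reaching a higher index outside the gaps
means crossing a whole gap, of length 1 after scaling. -/
theorem cellIndex_le_of_notMem_gapSet {n : ℕ} {N : ℝ} {q : ℕ} (hn : 0 < n)
    {x y : Set.Icc (0 : ℝ) 1} (hy : y ∉ gapSet n N q) (hxy : N * y < N * x + 1) :
    cellIndex n N q y ≤ cellIndex n N q x := by
  have hn' : (0 : ℝ) < n := by exact_mod_cast hn
  set i := cellIndex n N q x with hi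
  have hx : (N * x - q) / n ≤ i := Int.le_ceil _
  rw [div_le_iff₀ hn'] at hx
  refine Int.ceil_le.2 ?_
  rw [div_le_iff₀ hn']
  by_contra! hlt
  exact hy ⟨i, by linarith, by linarith⟩

theorem cellIndex_eq_of_notMem_gapSet {n : ℕ} {N : ℝ} {q : ℕ} (hn : 0 < n) (hN : 0 < N)
    {x y : Set.Icc (0 : ℝ) 1} (hx : x ∉ gapSet n N q) (hy : y ∉ gapSet n N q)
    (hxy : dist x y < 1 / N) : cellIndex n N q x = cellIndex n N q y := by
  rw [Subtype.dist_eq, Real.dist_eq, lt_div_iff₀ hN] at hxy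
  have h1 := mul_le_mul_of_nonneg_right (le_abs_self ((x : ℝ) - y)) hN.le
  have h2 := mul_le_mul_of_nonneg_right (neg_abs_le ((x : ℝ) - y)) hN.le
  exact le_antisymm (cellIndex_le_of_notMem_gapSet hn hx (by linarith))
    (cellIndex_le_of_notMem_gapSet hn hy (by linarith))

theorem finite_range_cellIndex {n : ℕ} {N : ℝ} (q : ℕ) (hN : 0 < N) :
    (Set.range (cellIndex n N q)).Finite := by
  refine (Set.finite_Icc ⌈(0 - q : ℝ) / n⌉ ⌈(N - q) / n⌉).subset ?_
  rintro _ ⟨x, rfl⟩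
  have h0 := x.2.1
  have h1 := x.2.2
  constructor
  · apply Int.ceil_le_ceil
    gcongr
    positivity
  · apply Int.ceil_le_ceil
    gcongr
    nlinarith

/-! ### One approximation step. -/

/-- One family of cells: on the cubes of the `q`-th family, a perturbation of the inner functions
is constant and separates the cubes, so that `f` is a function of the inner sum, up to its
oscillation. -/
theorem exists_near_approx_off_gapSet {d n : ℕ} (hn : 0 < n) (q : ℕ)
    (f : C(Fin d → Set.Icc (0 : ℝ) 1, ℝ)) (φ : Fin d → C(Set.Icc (0 : ℝ) 1, ℝ)) {r δ ε : ℝ}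
    (hr : 0 < r) (hδ : 0 < δ) (hf : ∀ x y, dist x y < r → |f x - f y| < ε)
    (hφ : ∀ p x y, dist x y < r → |φ p x - φ p y| < δ / 2) :
    ∃ ψ : Fin d → C(Set.Icc (0 : ℝ) 1, ℝ), (∀ p x, |ψ p x - φ p x| ≤ δ) ∧
      ∃ g : C(ℝ, ℝ), (∀ t, |g t| ≤ ‖f‖) ∧
        ∀ x, (∀ p, x p ∉ gapSet n (n / r) q) → |f x - g (∑ p, ψ p (x p))| ≤ ε := by
  have hn' : (0 : ℝ) < n := by exact_mod_cast hn
  have hN : 0 < n / r := div_pos hn' hr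
  set N := n / r with hNdef
  have hNr : n / N = r := by rw [hNdef]; field_simp
  set K : Set (Set.Icc (0 : ℝ) 1) := (gapSet n N q)ᶜ with hKdef
  have hK : IsClosed K := (isOpen_gapSet n N q).isClosed_compl
  have hcell : ∀ x y, cellIndex n N q x = cellIndex n N q y → dist x y < r := fun x y h =>
    hNr ▸ dist_lt_of_cellIndex_eq hn hN h
  -- The target for cell `i` is the value of `φ p` at a sample point of that cell; for indices of
  -- empty cells `Function.invFun` gives an arbitrary point, which is harmless.
  obtain ⟨v, hv, hvinj⟩ := exists_near_sum_injective
    (fun p i => φ p (Function.invFun (cellIndex n N q) i)) (half_pos hδ)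
  have hvφ : ∀ p y, |v p (cellIndex n N q y) - φ p y| ≤ δ := by
    intro p y
    have h1 := hv p (cellIndex n N q y)
    have h2 := hφ p _ _ (hcell _ _ (Function.invFun_eq (f := cellIndex n N q) ⟨y, rfl⟩))
    have h3 := abs_sub_le (v p (cellIndex n N q y))
      (φ p (Function.invFun (cellIndex n N q) (cellIndex n N q y))) (φ p y)
    linarith
  have hext : ∀ p, ∃ c : C(Set.Icc (0 : ℝ) 1, ℝ), (∀ y, |c y| ≤ δ) ∧
      ∀ y ∈ K, c y = v p (cellIndex n N q y) - φ p y := by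
    intro p
    refine exists_continuousMap_eqOn_abs_le hK (ContinuousOn.sub (fun y hy => ?_)
      (φ p).continuous.continuousOn) hδ.le fun y _ => hvφ p y
    refine (continuousWithinAt_const (b := v p (cellIndex n N q y))).congr_of_eventuallyEq ?_ rfl
    filter_upwards [self_mem_nhdsWithin,
      mem_nhdsWithin_of_mem_nhds (Metric.ball_mem_nhds y (one_div_pos.2 hN))] with z hz hzy
    rw [cellIndex_eq_of_notMem_gapSet hn hN hz hy hzy]
  choose c hc hcK using hext
  set Φ : (Fin d → Set.Icc (0 : ℝ) 1) → ℝ := fun x => ∑ p, v p (cellIndex n N q (x p)) with hΦ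
  have hfin : (Set.range Φ).Finite := by
    have hpi : (Set.univ.pi fun _ : Fin d => Set.range (cellIndex n N q)).Finite :=
      Set.Finite.pi fun _ => finite_range_cellIndex q hN
    refine (hpi.image fun s : Fin d → ℤ => ∑ p, v p (s p)).subset ?_
    rintro _ ⟨x, rfl⟩
    exact ⟨fun p => cellIndex n N q (x p), fun p _ => ⟨x p, rfl⟩, rfl⟩
  -- On a finite set of reals every function is continuous, so `f` at a sample point of each level
  -- set of `Φ` extends.
  obtain ⟨g, hg, hgΦ⟩ := exists_continuousMap_eqOn_abs_le hfin.isClosed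
    (h := fun t => f (Function.invFun Φ t)) (hfin.continuousOn _) (norm_nonneg f)
    fun t _ => f.norm_coe_le_norm _
  refine ⟨fun p => φ p + c p, fun p x => by simpa using hc p x, g, hg, fun x hx => ?_⟩
  have hsum : ∑ p, (φ p + c p) (x p) = Φ x :=
    Finset.sum_congr rfl fun p _ => by
      rw [ContinuousMap.add_apply, hcK p _ (hx p), add_sub_cancel]
  have hinv : Φ (Function.invFun Φ (Φ x)) = Φ x := Function.invFun_eq ⟨x, rfl⟩
  rw [hsum, hgΦ _ ⟨x, rfl⟩]
  refine (hf _ _ ((dist_pi_lt_iff hr).2 fun p => hcell _ _ ?_)).le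
  exact (congrFun (hvinj hinv) p).symm

/-- For any `f` the inner functions can be perturbed so that outer functions exist for which the
error is, up to `ε`, at most `2 d / n` times the norm of `f`. -/
theorem exists_near_sum_comp_approx {d n : ℕ} (hn : 0 < n)
    (f : C(Fin d → Set.Icc (0 : ℝ) 1, ℝ)) (φ : Fin d → Fin n → C(Set.Icc (0 : ℝ) 1, ℝ)) {δ ε : ℝ}
    (hδ : 0 < δ) (hε : 0 < ε) :
    ∃ ψ : Fin d → Fin n → C(Set.Icc (0 : ℝ) 1, ℝ), (∀ p q x, |ψ p q x - φ p q x| ≤ δ) ∧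
      ∃ g : Fin n → C(ℝ, ℝ), ∀ x, |f x - ∑ q, g q (∑ p, ψ p q (x p))| ≤ 2 * d / n * ‖f‖ + ε := by
  have hn' : (0 : ℝ) < n := by exact_mod_cast hn
  obtain ⟨r, hr, hf, hφ⟩ : ∃ r > 0, (∀ x y, dist x y < r → |f x - f y| < ε) ∧
      ∀ p q x y, dist x y < r → |φ p q x - φ p q y| < δ / 2 := by
    obtain ⟨r₁, hr₁, h₁⟩ := Metric.uniformContinuous_iff.1
      (CompactSpace.uniformContinuous_of_continuous f.continuous) ε hε
    have hunif : UniformContinuous fun x p q => φ p q x :=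
      CompactSpace.uniformContinuous_of_continuous (by fun_prop)
    obtain ⟨r₂, hr₂, h₂⟩ := Metric.uniformContinuous_iff.1 hunif (δ / 2) (half_pos hδ)
    refine ⟨min r₁ r₂, lt_min hr₁ hr₂, fun x y h => h₁ (h.trans_le (min_le_left _ _)),
      fun p q x y h => ?_⟩
    have h3 := h₂ (h.trans_le (min_le_right _ _))
    exact (dist_pi_lt_iff (half_pos hδ)).1 ((dist_pi_lt_iff (half_pos hδ)).1 h3 p) q
  choose ψ hψ g hg hfg using fun q : Fin n =>
    exists_near_approx_off_gapSet hn q f (fun p => φ p q) hr hδ hf fun p => hφ p q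
  refine ⟨fun p q => ψ q p, fun p q => hψ q p, fun q => (1 / n : ℝ) • g q, fun x => ?_⟩
  classical
  have hterm : ∀ q, |f x - g q (∑ p, ψ q p (x p))| ≤
      ε + ∑ p, if x p ∈ gapSet n (n / r) q then 2 * ‖f‖ else 0 := by
    intro q
    have hnn : ∀ p ∈ Finset.univ, 0 ≤ if x p ∈ gapSet n (n / r) q then 2 * ‖f‖ else 0 := by
      intro p _
      split_ifs <;> positivity
    by_cases hx : ∀ p, x p ∉ gapSet n (n / r) q
    · exact (hfg q x hx).trans (le_add_of_nonneg_right (Finset.sum_nonneg hnn))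
    · push Not at hx
      obtain ⟨p, hp⟩ := hx
      have h1 := Finset.single_le_sum hnn (Finset.mem_univ p)
      rw [if_pos hp] at h1
      have h2 : |f x| ≤ ‖f‖ := f.norm_coe_le_norm x
      have h3 := abs_sub (f x) (g q (∑ p, ψ q p (x p)))
      have h4 := hg q (∑ p, ψ q p (x p))
      linarith
  -- Each coordinate spoils at most one family, so the total penalty is at most `d * (2 * ‖f‖)`.
  have hcount : ∀ p, ∑ q : Fin n, (if x p ∈ gapSet n (n / r) q then 2 * ‖f‖ else 0) ≤ 2 * ‖f‖ := by
    intro p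
    rw [← Finset.sum_filter, Finset.sum_const, nsmul_eq_mul]
    refine mul_le_of_le_one_left (by positivity) ?_
    exact_mod_cast Finset.card_le_one.2 fun a ha b hb => Fin.ext
      (gapSet_unique a.2 b.2 (Finset.mem_filter.1 ha).2 (Finset.mem_filter.1 hb).2)
  have hsum : f x - ∑ q, ((1 / n : ℝ) • g q) (∑ p, ψ q p (x p)) =
      (∑ q, (f x - g q (∑ p, ψ q p (x p)))) / n := by
    simp only [ContinuousMap.smul_apply, smul_eq_mul, ← Finset.mul_sum, Finset.sum_sub_distrib,
      Finset.sum_const, Finset.card_univ, Fintype.card_fin, nsmul_eq_mul]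
    field_simp
  rw [hsum, abs_div, abs_of_pos hn', div_le_iff₀ hn']
  calc |∑ q, (f x - g q (∑ p, ψ q p (x p)))|
      ≤ ∑ q, |f x - g q (∑ p, ψ q p (x p))| := Finset.abs_sum_le_sum_abs _ _
    _ ≤ ∑ q : Fin n, (ε + ∑ p, if x p ∈ gapSet n (n / r) q then 2 * ‖f‖ else 0) :=
        Finset.sum_le_sum fun q _ => hterm q
    _ ≤ n * ε + d * (2 * ‖f‖) := by
        rw [Finset.sum_add_distrib, Finset.sum_comm]
        refine add_le_add (by simp) ((Finset.sum_le_sum fun p _ => hcount p).trans (by simp))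
    _ = (2 * d / n * ‖f‖ + ε) * n := by field_simp; ring

/-! ### Vanishing of the optimal error. -/

/-- The function `x ↦ ∑ q, g q (∑ p, ψ p q (x p))` on the cube. -/
noncomputable def superposition {d n : ℕ} (g : Fin n → C(ℝ, ℝ))
    (ψ : Fin d → Fin n → C(Set.Icc (0 : ℝ) 1, ℝ)) : C(Fin d → Set.Icc (0 : ℝ) 1, ℝ) where
  toFun x := ∑ q, g q (∑ p, ψ p q (x p))

/-- With the outer functions fixed, the superposition depends continuously on the inner ones. -/
theorem continuous_superposition {d n : ℕ} (g : Fin n → C(ℝ, ℝ)) :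
    Continuous fun ψ : Fin d → Fin n → C(Set.Icc (0 : ℝ) 1, ℝ) => superposition g ψ := by
  refine ContinuousMap.continuous_of_continuous_uncurry _ ?_
  simp only [Function.uncurry_def, superposition, ContinuousMap.coe_mk]
  fun_prop

/-- **Approximate Kolmogorov superposition theorem.** -/
theorem exists_superposition_norm_sub_lt {d n : ℕ} (hdn : 2 * d < n)
    (f : C(Fin d → Set.Icc (0 : ℝ) 1, ℝ)) {ε : ℝ} (hε : 0 < ε) :
    ∃ (g : Fin n → C(ℝ, ℝ)) (ψ : Fin d → Fin n → C(Set.Icc (0 : ℝ) 1, ℝ)),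
      ‖f - superposition g ψ‖ < ε := by
  have hn : 0 < n := by lia
  have hn' : (0 : ℝ) < n := by exact_mod_cast hn
  set θ : ℝ := 2 * d / n with hθ
  have hθ0 : 0 ≤ θ := by positivity
  have hθ1 : θ < 1 := by
    rw [hθ, div_lt_one hn']
    exact_mod_cast hdn
  set S : Set ℝ := Set.range fun z : (Fin n → C(ℝ, ℝ)) ×
    (Fin d → Fin n → C(Set.Icc (0 : ℝ) 1, ℝ)) => ‖f - superposition z.1 z.2‖ with hS
  have hbdd : BddBelow S := ⟨0, by rintro _ ⟨z, rfl⟩; exact norm_nonneg _⟩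
  have hne : S.Nonempty := Set.range_nonempty _
  suffices h : sInf S < ε by
    obtain ⟨_, ⟨z, rfl⟩, hz⟩ := exists_lt_of_csInf_lt hne h
    exact ⟨z.1, z.2, hz⟩
  by_contra! hcon
  have hE : 0 < sInf S := hε.trans_le hcon
  -- The new error is at most `θ * (sInf S + η) + 2 * η`, and `3 * η < (1 - θ) * sInf S` puts it
  -- below the infimum.
  set η : ℝ := (1 - θ) * sInf S / 4 with hη
  have hη0 : 0 < η := by
    have := sub_pos.2 hθ1
    positivity
  obtain ⟨_, ⟨⟨g, φ⟩, rfl⟩, hz⟩ := exists_lt_of_csInf_lt hne (lt_add_of_pos_right (sInf S) hη0)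
  simp only at hz
  obtain ⟨δ, hδ, hcont⟩ := Metric.continuous_iff.1 (continuous_superposition g) φ η hη0
  obtain ⟨ψ, hψ, h, hh⟩ := exists_near_sum_comp_approx hn (f - superposition g φ) φ
    (half_pos hδ) hη0
  have hclose : dist ψ φ ≤ δ / 2 :=
    (dist_pi_le_iff (by positivity)).2 fun p => (dist_pi_le_iff (by positivity)).2 fun q =>
      (ContinuousMap.dist_le (by positivity)).2 fun x => hψ p q x
  have h1 := hcont ψ (by linarith)
  rw [dist_eq_norm] at h1
  have h2 : ‖f - superposition g φ - superposition h ψ‖ ≤ θ * ‖f - superposition g φ‖ + η :=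
    (ContinuousMap.norm_le _ (by positivity)).2 hh
  have h3 : superposition (g + h) ψ = superposition g ψ + superposition h ψ := by
    ext x
    simp [superposition, Finset.sum_add_distrib]
  have h4 : ‖f - superposition (g + h) ψ‖ ≤
      ‖f - superposition g φ - superposition h ψ‖ + ‖superposition g ψ - superposition g φ‖ := by
    rw [h3]
    refine le_of_eq_of_le (congrArg _ ?_) (norm_sub_le _ _)
    abel
  have h5 : sInf S ≤ ‖f - superposition (g + h) ψ‖ := csInf_le hbdd ⟨(g + h, ψ), rfl⟩
  nlinarith

/-! ### Transfer to the ansatz spaces. -/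

/-- A dense subset of `C(T, ℝ)` approximates uniformly along any map from a compact space. -/
theorem Dense.exists_abs_comp_sub_lt {X T : Type*} [TopologicalSpace X] [CompactSpace X]
    [TopologicalSpace T] {A : Set C(T, ℝ)} (hA : Dense A) (j : C(X, T)) (u : C(T, ℝ)) {η : ℝ}
    (hη : 0 < η) : ∃ a ∈ A, ∀ x, |a (j x) - u (j x)| < η := by
  obtain ⟨a, ha, haA⟩ := hA.inter_open_nonempty
    ((fun a : C(T, ℝ) => a.comp j) ⁻¹' Metric.ball (u.comp j) η)
    (Metric.isOpen_ball.preimage (ContinuousMap.continuous_precomp j))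
    ⟨u, Metric.mem_ball_self hη⟩
  exact ⟨a, haA, fun x => (ContinuousMap.dist_apply_le_dist (f := a.comp j) (g := u.comp j)
    x).trans_lt (Metric.mem_ball.1 ha)⟩

/-- A superposition can be rewritten with inner sums in any prescribed nondegenerate interval. -/
theorem exists_superposition_eq_of_center {d n : ℕ} (hd : 0 < d) (g : Fin n → C(ℝ, ℝ))
    (ψ : Fin d → Fin n → C(Set.Icc (0 : ℝ) 1, ℝ)) (c : ℝ) {l : ℝ} (hl : 0 < l) :
    ∃ (g' : Fin n → C(ℝ, ℝ)) (ψ' : Fin d → Fin n → C(Set.Icc (0 : ℝ) 1, ℝ)),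
      superposition g' ψ' = superposition g ψ ∧
        ∀ q (x : Fin d → Set.Icc (0 : ℝ) 1), |∑ p, ψ' p q (x p) - c| ≤ l := by
  have hd' : (0 : ℝ) < d := by exact_mod_cast hd
  set R : ℝ := d * ‖ψ‖ + 1 with hR
  have hR0 : 0 < R := by positivity
  have hbound : ∀ q (x : Fin d → Set.Icc (0 : ℝ) 1), |∑ p, ψ p q (x p)| ≤ R := by
    intro q x
    calc |∑ p, ψ p q (x p)| ≤ ∑ p, |ψ p q (x p)| := Finset.abs_sum_le_sum_abs _ _
      _ ≤ ∑ _p : Fin d, ‖ψ‖ := Finset.sum_le_sum fun p _ =>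
          ((ψ p q).norm_coe_le_norm (x p)).trans ((norm_le_pi_norm (ψ p) q).trans
            (norm_le_pi_norm ψ p))
      _ ≤ R := by simp [hR]
  have hs : 0 < l / R := div_pos hl hR0
  have hsum : ∀ q (x : Fin d → Set.Icc (0 : ℝ) 1),
      ∑ p, ((l / R) • ψ p q + ContinuousMap.const (Set.Icc (0 : ℝ) 1) (c / d : ℝ) :
        C(Set.Icc (0 : ℝ) 1, ℝ)) (x p) =
        l / R * ∑ p, ψ p q (x p) + c := by
    intro q x
    simp only [ContinuousMap.add_apply, ContinuousMap.smul_apply, smul_eq_mul,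
      ContinuousMap.const_apply, Finset.sum_add_distrib, ← Finset.mul_sum, Finset.sum_const,
      Finset.card_univ, Fintype.card_fin, nsmul_eq_mul]
    field_simp
  -- The inner sum undergoes `t ↦ l / R * t + c`, each inner function carrying `c / d`; the outer
  -- function undoes it.
  refine ⟨fun q => (g q).comp ⟨fun t => (t - c) / (l / R), by fun_prop⟩,
    fun p q => (l / R) • ψ p q + ContinuousMap.const (Set.Icc (0 : ℝ) 1) (c / d : ℝ), ?_, fun q x => ?_⟩
  · ext x
    simp only [superposition, ContinuousMap.coe_mk, ContinuousMap.comp_apply, hsum,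
      add_sub_cancel_right, mul_div_cancel_left₀ _ hs.ne']
  · rw [hsum, add_sub_cancel_right, abs_mul, abs_of_pos hs]
    calc l / R * |∑ p, ψ p q (x p)| ≤ l / R * R := by gcongr; exact hbound q x
      _ = l := by field_simp

/-- Two-block functions with dense ansatz spaces approximate every continuous function. -/
theorem exists_mem_twoBlock_norm_sub_lt {d m : ℕ} (hd : 0 < d) (hm : 2 * d ≤ m)
    {Ig Iψ : Set ℝ} (hIg : Ig.OrdConnected) (hIg' : Ig.Nontrivial)
    (hψ : Set.Icc (0 : ℝ) 1 ⊆ Iψ) {Ag : Set C(Ig, ℝ)} {Aψ : Set C(Iψ, ℝ)}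
    (hAg : Dense Ag) (hAψ : Dense Aψ) (f : C(Fin d → Set.Icc (0 : ℝ) 1, ℝ)) {ε : ℝ} (hε : 0 < ε) :
    ∃ F ∈ twoBlock d m hψ Ag Aψ, ‖f - F‖ < ε := by
  have hd' : (0 : ℝ) < d := by exact_mod_cast hd
  obtain ⟨a, ha, b, hb, hab⟩ := hIg'.exists_lt
  have hsub : Set.Icc a b ⊆ Ig := hIg.out ha hb
  obtain ⟨g₀, ψ₀, h₀⟩ := exists_superposition_norm_sub_lt (Nat.lt_succ_of_le hm) f
    (show 0 < ε / 4 by positivity)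
  obtain ⟨g, ψ, hgψ, hc⟩ := exists_superposition_eq_of_center hd g₀ ψ₀ ((a + b) / 2)
    (show 0 < (b - a) / 4 by linarith)
  rw [← hgψ] at h₀
  obtain ⟨δ, hδ, hcont⟩ := Metric.continuous_iff.1 (continuous_superposition g) ψ (ε / 4)
    (by positivity)
  -- The first bound controls the superposition with `g` fixed; the second keeps the new inner sums
  -- in `[a, b]`.
  set η : ℝ := min (δ / 2) ((b - a) / 4 / d) with hη
  have hη0 : 0 < η := lt_min (by positivity) (div_pos (by linarith) hd')
  have hΨ : ∀ p q, ∃ Ψ ∈ Aψ, ∀ x : Set.Icc (0 : ℝ) 1, |Ψ (Set.inclusion hψ x) - ψ p q x| < η := by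
    intro p q
    obtain ⟨Ψ, hΨA, hΨ⟩ := hAψ.exists_abs_comp_sub_lt
      ⟨Set.inclusion hψ, continuous_inclusion hψ⟩
      ((ψ p q).comp ⟨fun t : Iψ => Set.projIcc 0 1 zero_le_one t, by fun_prop⟩) hη0
    refine ⟨Ψ, hΨA, fun x => ?_⟩
    simpa using hΨ x
  choose Ψ hΨA hΨ using hΨ
  have hG : ∀ q, ∃ G ∈ Ag, ∀ t (ht : t ∈ Set.Icc a b),
      |G ⟨t, hsub ht⟩ - g q t| < ε / (4 * (m + 1)) := by
    intro q
    obtain ⟨G, hGA, hG⟩ := hAg.exists_abs_comp_sub_lt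
      ⟨Set.inclusion hsub, continuous_inclusion hsub⟩
      ((g q).comp ⟨Subtype.val, continuous_subtype_val⟩)
      (show 0 < ε / (4 * (m + 1)) by positivity)
    exact ⟨G, hGA, fun t ht => hG ⟨t, ht⟩⟩
  choose G hGA hG using hG
  have hmem : ∀ q x, innerSum hψ Ψ q x ∈ Set.Icc a b := by
    intro q x
    have h1 : |innerSum hψ Ψ q x - ∑ p, ψ p q (x p)| ≤ (b - a) / 4 := by
      rw [innerSum, ← Finset.sum_sub_distrib]
      calc _ ≤ ∑ p, |Ψ p q (Set.inclusion hψ (x p)) - ψ p q (x p)| :=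
            Finset.abs_sum_le_sum_abs _ _
        _ ≤ ∑ _p : Fin d, (b - a) / 4 / d :=
            Finset.sum_le_sum fun p _ => (hΨ p q (x p)).le.trans (min_le_right _ _)
        _ = (b - a) / 4 := by
            simp only [Finset.sum_const, Finset.card_univ, Fintype.card_fin, nsmul_eq_mul]
            field_simp
    have h2 := abs_le.1 h1
    have h3 := abs_le.1 (hc q x)
    constructor <;> linarith
  set Ψ₁ : Fin d → Fin (m + 1) → C(Set.Icc (0 : ℝ) 1, ℝ) := fun p q =>
    (Ψ p q).comp ⟨Set.inclusion hψ, continuous_inclusion hψ⟩ with hΨ₁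
  have hdist : dist Ψ₁ ψ ≤ δ / 2 :=
    (dist_pi_le_iff (by positivity)).2 fun p => (dist_pi_le_iff (by positivity)).2 fun q =>
      (ContinuousMap.dist_le (by positivity)).2 fun x => (hΨ p q x).le.trans (min_le_left _ _)
  have h₁ := hcont Ψ₁ (by linarith)
  let F : C(Fin d → Set.Icc (0 : ℝ) 1, ℝ) :=
    ⟨fun x => ∑ q, G q ⟨innerSum hψ Ψ q x, hsub (hmem q x)⟩, by
      refine continuous_finsetSum _ fun q _ => (G q).continuous.comp (Continuous.subtype_mk ?_ _)
      exact continuous_finsetSum _ fun p _ => (Ψ p q).continuous.comp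
        ((continuous_inclusion hψ).comp (continuous_apply p))⟩
  have h₂ : ‖superposition g Ψ₁ - F‖ ≤ ε / 4 := by
    refine (ContinuousMap.norm_le _ (by positivity)).2 fun x => ?_
    change |∑ q, g q (innerSum hψ Ψ q x) - ∑ q, G q ⟨innerSum hψ Ψ q x, hsub (hmem q x)⟩| ≤ _
    rw [← Finset.sum_sub_distrib]
    calc _ ≤ ∑ q, |g q (innerSum hψ Ψ q x) - G q ⟨innerSum hψ Ψ q x, hsub (hmem q x)⟩| :=
          Finset.abs_sum_le_sum_abs _ _
      _ ≤ ∑ _q : Fin (m + 1), ε / (4 * (m + 1)) := Finset.sum_le_sum fun q _ => by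
          rw [abs_sub_comm]
          exact (hG q _ (hmem q x)).le
      _ = ε / 4 := by
          simp only [Finset.sum_const, Finset.card_univ, Fintype.card_fin, nsmul_eq_mul]
          push_cast
          field_simp
  refine ⟨F, ⟨G, Ψ, hGA, hΨA, fun q x => hsub (hmem q x), fun x => rfl⟩, ?_⟩
  rw [dist_comm, dist_eq_norm] at h₁
  have h₃ := norm_sub_le_norm_sub_add_norm_sub f (superposition g ψ) F
  have h₄ := norm_sub_le_norm_sub_add_norm_sub (superposition g ψ) (superposition g Ψ₁) F
  linarith

/-- For directed families of ansatz spaces, a two-block function over the unions is one over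
single members. -/
theorem exists_mem_twoBlock_of_directed {d m : ℕ} {Ig Iψ : Set ℝ}
    (hψ : Set.Icc (0 : ℝ) 1 ⊆ Iψ) {Ag : ℕ → Set C(Ig, ℝ)} {Aψ : ℕ → Set C(Iψ, ℝ)}
    (hAg : Directed (· ⊆ ·) Ag) (hAψ : Directed (· ⊆ ·) Aψ)
    {F : C(Fin d → Set.Icc (0 : ℝ) 1, ℝ)} (hF : F ∈ twoBlock d m hψ (⋃ M, Ag M) (⋃ M, Aψ M)) :
    ∃ Mg Mψ, F ∈ twoBlock d m hψ (Ag Mg) (Aψ Mψ) := by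
  obtain ⟨G, Ψ, hG, hΨ, h⟩ := hF
  choose i hi using fun q => Set.mem_iUnion.1 (hG q)
  choose j hj using fun z : Fin d × Fin (m + 1) => Set.mem_iUnion.1 (hΨ z.1 z.2)
  obtain ⟨Mg, hMg⟩ := hAg.finite_le i
  obtain ⟨Mψ, hMψ⟩ := hAψ.finite_le j
  exact ⟨Mg, Mψ, G, Ψ, fun q => hMg q (hi q), fun p q => hMψ (p, q) (hj (p, q)), h⟩

theorem theorem1 (d m : ℕ) (hd : 2 ≤ d) (hm : 2 * d ≤ m)
    (Ig Iψ : Set ℝ) (hIg : Ig.OrdConnected) (hIg' : Ig.Nontrivial)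
    (hIψ : Iψ.OrdConnected) (hψ : Set.Icc (0 : ℝ) 1 ⊆ Iψ)
    (Ag : ℕ → Set C(Ig, ℝ)) (Aψ : ℕ → Set C(Iψ, ℝ))
    (hAg : Dense (⋃ M, Ag M)) (hAψ : Dense (⋃ M, Aψ M)) :
    Dense (twoBlock d m hψ (⋃ M, Ag M) (⋃ M, Aψ M)) ∧
    (Directed (· ⊆ ·) Ag → Directed (· ⊆ ·) Aψ →
      ∀ (f : C(Fin d → Set.Icc (0 : ℝ) 1, ℝ)) (ε : ℝ), 0 < ε →
        ∃ Mg Mψ : ℕ, ∃ F ∈ twoBlock d m hψ (Ag Mg) (Aψ Mψ), ‖f - F‖ < ε) := by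
  have key := fun (f : C(Fin d → Set.Icc (0 : ℝ) 1, ℝ)) (ε : ℝ) (hε : 0 < ε) =>
    exists_mem_twoBlock_norm_sub_lt (lt_of_lt_of_le two_pos hd) hm hIg hIg' hψ hAg hAψ f hε
  refine ⟨Metric.dense_iff.2 fun f ε hε => ?_, fun hDg hDψ f ε hε => ?_⟩
  · obtain ⟨F, hF, hfF⟩ := key f ε hε
    exact ⟨F, by rwa [Metric.mem_ball, dist_comm, dist_eq_norm], hF⟩
  · obtain ⟨F, hF, hfF⟩ := key f ε hε
    obtain ⟨Mg, Mψ, hM⟩ := exists_mem_twoBlock_of_directed hψ hDg hDψ hF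
    exact ⟨Mg, Mψ, F, hM, hfF⟩
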